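/- Fix real numbers $m,\varepsilon>0$. For each $\delta\in(0,1)$ let $A_k(x,t)=A_k(x,t,m,\varepsilon,\delta)$, $k\in\{1,2\}$, be the unique pair of complex-valued functions on the set $\{(x,t)\in\mathbb{R}^2: 2x/\varepsilon,\ 2t/\varepsilon,\ (x+t)/\varepsilon\in\mathbb{Z}\}$ satisfying the following three conditions. 1. For each $(x,t)$ with $2x/\varepsilon$ and $2t/\varepsilon$ even, $$A_1(x,t)=\frac{1}{\sqrt{1+m^2\varepsilon^2}}\left(A_1\left(x+\tfrac{\varepsilon}{2},t-\tfrac{\varepsilon}{2}\right)+m\varepsilon\,A_2\left(x+\tfrac{\varepsilon}{2},t-\tfrac{\varepsilon}{2}\right)\right),$$ $$A_2(x,t)=\frac{1}{\sqrt{1+m^2\varepsilon^2}}\left(A_2\left(x-\tfrac{\varepsilon}{2},t-\tfrac{\varepsilon}{2}\right)-m\varepsilon\,A_1\left(x-\tfrac{\varepsilon}{2},t-\tfrac{\varepsilon}{2}\right)\right)+2\delta_{x0}\delta_{t0},$$ where $\delta_{xy}$ denotes the Kronecker delta. 2. For each $(x,t)$ with $2x/\varepsilon$ and $2t/\varepsilon$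 odd, $$A_1(x,t)=\frac{1}{\sqrt{1-\delta^2}}\left(A_1\left(x+\tfrac{\varepsilon}{2},t-\tfrac{\varepsilon}{2}\right)-i\delta\,A_2\left(x+\tfrac{\varepsilon}{2},t-\tfrac{\varepsilon}{2}\right)\right),$$ $$A_2(x,t)=\frac{1}{\sqrt{1-\delta^2}}\left(A_2\left(x-\tfrac{\varepsilon}{2},t-\tfrac{\varepsilon}{2}\right)+i\delta\,A_1\left(x-\tfrac{\varepsilon}{2},t-\tfrac{\varepsilon}{2}\right)\right).$$ 3. $\sum_{(x,t)\in\varepsilon\mathbb{Z}^2}\left(|A_1(x,t)|^2+|A_2(x,t)|^2\right)<\infty$. For $(x,t)\in\varepsilon\mathbb{Z}^2$ and $k\in\{1,2\}$ let the lattice propagator be $$\widetilde A_k(x,t):=\lim_{\delta\searrow 0}A_k(x,t,m,\varepsilon,\delta).$$ **Proposition (Charge conservation).** For each $t\in\varepsilon\mathbb{Z}$, $$\sum_{x\in\varepsilon\mathbb{Z}}\frac{|\widetilde A_1(x,t)|^2+|\widetilde A_2(x,t)|^2}{2}=1.$$ -/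

import Mathlib

open Filter Topology

namespace FeynmanCheckers

/-- The axioms for a pair of complex-valued functions `A₁`, `A₂` on the lattice
`{(x, t) ∈ ℝ² : 2x/ε, 2t/ε, (x+t)/ε ∈ ℤ}`, the disjoint union of `εℤ²` (where `2x/ε`, `2t/ε` are
both even) and of its dual (where both are odd). The functions are written as total functions of
two real variables; only their values at lattice points are constrained (or ever used). -/
structure IsLatticeSolution (m ε δ : ℝ) (A₁ A₂ : ℝ → ℝ → ℂ) : Prop where
  even_one : ∀ x t : ℝ, (∃ a : ℤ, Even a ∧ 2 * x / ε = a) → (∃ b : ℤ, Even b ∧ 2 * t / ε = b) →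
    A₁ x t = 1 / (Real.sqrt (1 + m ^ 2 * ε ^ 2) : ℂ) *
      (A₁ (x + ε / 2) (t - ε / 2) + (m : ℂ) * ε * A₂ (x + ε / 2) (t - ε / 2))
  even_two : ∀ x t : ℝ, (∃ a : ℤ, Even a ∧ 2 * x / ε = a) → (∃ b : ℤ, Even b ∧ 2 * t / ε = b) →
    A₂ x t = 1 / (Real.sqrt (1 + m ^ 2 * ε ^ 2) : ℂ) *
      (A₂ (x - ε / 2) (t - ε / 2) - (m : ℂ) * ε * A₁ (x - ε / 2) (t - ε / 2))
      + 2 * (if x = 0 then 1 else 0) * (if t = 0 then 1 else 0)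
  odd_one : ∀ x t : ℝ, (∃ a : ℤ, Odd a ∧ 2 * x / ε = a) → (∃ b : ℤ, Odd b ∧ 2 * t / ε = b) →
    A₁ x t = 1 / (Real.sqrt (1 - δ ^ 2) : ℂ) *
      (A₁ (x + ε / 2) (t - ε / 2) - Complex.I * δ * A₂ (x + ε / 2) (t - ε / 2))
  odd_two : ∀ x t : ℝ, (∃ a : ℤ, Odd a ∧ 2 * x / ε = a) → (∃ b : ℤ, Odd b ∧ 2 * t / ε = b) →
    A₂ x t = 1 / (Real.sqrt (1 - δ ^ 2) : ℂ) *
      (A₂ (x - ε / 2) (t - ε / 2) + Complex.I * δ * A₁ (x - ε / 2) (t - ε / 2))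
  /-- Square-summability over `εℤ²`; `AddSubgroup.zmultiples ε` is `εℤ ⊆ ℝ`. -/
  summable : Summable fun p : AddSubgroup.zmultiples ε × AddSubgroup.zmultiples ε =>
    ‖A₁ p.1 p.2‖ ^ 2 + ‖A₂ p.1 p.2‖ ^ 2

/-- The pair `(A₁, A₂)` solving the axioms with parameters `m`, `ε`, `δ`. -/
noncomputable def latticeSolution (m ε δ : ℝ) : (ℝ → ℝ → ℂ) × (ℝ → ℝ → ℂ) :=
  Classical.epsilon fun A => IsLatticeSolution m ε δ A.1 A.2

/-- First component of the lattice propagator, the limit of `A₁(x, t, m, ε, δ)` as `δ ↘ 0`. -/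
noncomputable def propagatorOne (m ε x t : ℝ) : ℂ :=
  limUnder (𝓝[>] (0 : ℝ)) fun δ => (latticeSolution m ε δ).1 x t

/-- Second component of the lattice propagator, the limit of `A₂(x, t, m, ε, δ)` as `δ ↘ 0`. -/
noncomputable def propagatorTwo (m ε x t : ℝ) : ℂ :=
  limUnder (𝓝[>] (0 : ℝ)) fun δ => (latticeSolution m ε δ).2 x t

end FeynmanCheckers

namespace FeynmanCheckers

open Complex MeasureTheory AddCircle
open scoped ComplexConjugate

/-! ### The dispersion relation -/

/-! Substituting the equations on the odd points into those on the even points leaves a system on `ℤ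
× ℤ` with constants κ = `coupling` and μ = mε. A Fourier transform in space turns it into u_k = M
u_{k-1} + 2 e₂ [k = 0], where M is a 2×2 matrix with determinant 1 and trace 2τ, τ = κ(Re z + iδμ),
|z| = 1. The eigenvalues of M are λ and 1/λ, and for δ > 0 and κ² < 1 one of them satisfies |λ| < 1.
Hence the Green function λ^|k| / (-2i√(1-τ²)) of the trace recurrence decays in both time
directions, and the Fourier coefficients of the symbols built from it form a square-summable
solution (`isIntegerSolution_amplitude`).

This is the only such solution (`IsIntegerSolution.unique`): each component of a difference of two
solutions satisfies a lattice Klein–Gordon equation whose mass term has imaginary part 2κδμ ≠ 0, and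
pairing that equation with the conjugate forces the difference to vanish.

As δ ↘ 0 the denominators stay away from zero, because κ² < 1 in the limit; dominated convergence
then identifies the propagator with the amplitudes at δ = 0. There |λ| = 1, and the charge density
in the dual variable is 1 ∓ κ Im z / √(1-τ²) (`charge_density`). The correction is odd under z ↦
conj z and integrates to zero, so Parseval gives total charge 1 (`hasSum_charge`). -/

/-- Half the trace of the transfer matrix at `z = exp (-ip)`. -/
noncomputable def halfTrace (κ μ δ : ℝ) (z : ℂ) : ℂ := κ * (z.re + I * δ * μ)

/-- The square root of `1 - τ ^ 2` with positive real part, `τ` being half the trace of the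
transfer matrix. -/
noncomputable def discRoot (κ μ δ : ℝ) (z : ℂ) : ℂ := (1 - halfTrace κ μ δ z ^ 2) ^ (2⁻¹ : ℂ)

/-- The eigenvalue of the transfer matrix in the closed unit disc. -/
noncomputable def decayingRoot (κ μ δ : ℝ) (z : ℂ) : ℂ :=
  halfTrace κ μ δ z - I * discRoot κ μ δ z

/-- The reciprocal of `decayingRoot`. -/
noncomputable def growingRoot (κ μ δ : ℝ) (z : ℂ) : ℂ :=
  halfTrace κ μ δ z + I * discRoot κ μ δ z

/-- The bounded Green function of `g (k + 1) + g (k - 1) - 2 * τ * g k`. -/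
noncomputable def green (κ μ δ : ℝ) (k : ℤ) (z : ℂ) : ℂ :=
  decayingRoot κ μ δ z ^ k.natAbs / (-2 * I * discRoot κ μ δ z)

/-- The Fourier transform in the space variable of the first component. -/
noncomputable def symbolOne (κ μ δ : ℝ) (k : ℤ) (z : ℂ) : ℂ :=
  2 * κ * (μ - I * δ * conj z) * green κ μ δ k z

/-- The Fourier transform in the space variable of the second component. -/
noncomputable def symbolTwo (κ μ δ : ℝ) (k : ℤ) (z : ℂ) : ℂ :=
  2 * green κ μ δ (k + 1) z - 2 * κ * (conj z + I * δ * μ) * green κ μ δ k z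

section Pointwise

variable {κ μ δ : ℝ} {z : ℂ}

lemma halfTrace_re : (halfTrace κ μ δ z).re = κ * z.re := by simp [halfTrace]

lemma halfTrace_im : (halfTrace κ μ δ z).im = κ * (δ * μ) := by simp [halfTrace]

lemma re_sq_le_one (hz : ‖z‖ = 1) : z.re ^ 2 ≤ 1 := by
  have h := Complex.abs_re_le_norm z
  rw [hz] at h
  exact (sq_le_one_iff_abs_le_one _).2 h

/-- The imaginary part of τ only increases Re(1 - τ²). For κ² < 1 this keeps 1 - τ² off the branch
cut of the square root. -/
lemma one_sub_sq_le_re (hz : ‖z‖ = 1) : 1 - κ ^ 2 ≤ (1 - halfTrace κ μ δ z ^ 2).re := by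
  have h : (1 - halfTrace κ μ δ z ^ 2).re = 1 - (κ * z.re) ^ 2 + (κ * (δ * μ)) ^ 2 := by
    rw [sq, sub_re, mul_re, halfTrace_re, halfTrace_im, one_re]; ring
  rw [h, mul_pow]
  nlinarith [re_sq_le_one hz, sq_nonneg (κ * (δ * μ)), sq_nonneg κ]

lemma re_pos (hκ : κ ^ 2 < 1) (hz : ‖z‖ = 1) : 0 < (1 - halfTrace κ μ δ z ^ 2).re :=
  (sub_pos.2 hκ).trans_le (one_sub_sq_le_re hz)

lemma discRoot_sq : discRoot κ μ δ z ^ 2 = 1 - halfTrace κ μ δ z ^ 2 := by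
  simp [discRoot]

lemma discRoot_re_pos (hκ : κ ^ 2 < 1) (hz : ‖z‖ = 1) : 0 < (discRoot κ μ δ z).re := by
  rw [discRoot, Complex.cpow_inv_two_re]
  have := re_pos (μ := μ) (δ := δ) hκ hz
  positivity

lemma discRoot_ne_zero (hκ : κ ^ 2 < 1) (hz : ‖z‖ = 1) : discRoot κ μ δ z ≠ 0 := by
  intro h
  simpa [h] using discRoot_re_pos (μ := μ) (δ := δ) hκ hz

lemma one_sub_sq_le_norm_discRoot_sq (hz : ‖z‖ = 1) :
    1 - κ ^ 2 ≤ ‖discRoot κ μ δ z‖ ^ 2 := by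
  rw [← norm_pow, discRoot_sq]
  exact (one_sub_sq_le_re hz).trans (Complex.re_le_norm _)

lemma decayingRoot_mul_growingRoot :
    decayingRoot κ μ δ z * growingRoot κ μ δ z = 1 := by
  rw [decayingRoot, growingRoot]
  linear_combination discRoot κ μ δ z ^ 2 * (-I_sq) + discRoot_sq (κ := κ) (μ := μ) (δ := δ) (z := z)

lemma growingRoot_im_pos (hκ : κ ^ 2 < 1) (hp : 0 ≤ κ * (δ * μ)) (hz : ‖z‖ = 1) :
    0 < (growingRoot κ μ δ z).im := by
  have := discRoot_re_pos (μ := μ) (δ := δ) hκ hz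
  simp only [growingRoot, add_im, halfTrace_im, I_mul_im]
  linarith

/-- Imaginary parts are compared in λ + λ⁻¹ = 2τ, using Im λ = -|λ|² Im λ⁻¹. The sign of Im τ = κδμ
thereby decides whether |λ| < 1. -/
lemma growingRoot_im_mul (κ μ δ : ℝ) (z : ℂ) :
    (growingRoot κ μ δ z).im * (1 - ‖decayingRoot κ μ δ z‖ ^ 2) = 2 * (κ * (δ * μ)) := by
  have h1 : decayingRoot κ μ δ z + growingRoot κ μ δ z = 2 * halfTrace κ μ δ z := by
    rw [decayingRoot, growingRoot]; ring
  have h2 : decayingRoot κ μ δ z = (growingRoot κ μ δ z)⁻¹ :=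
    eq_inv_of_mul_eq_one_left decayingRoot_mul_growingRoot
  have h3 := congrArg Complex.im h1
  simp only [add_im, mul_im, re_ofNat, im_ofNat, halfTrace_im, zero_mul, add_zero] at h3
  have h4 : (decayingRoot κ μ δ z).im =
      -(growingRoot κ μ δ z).im * ‖decayingRoot κ μ δ z‖ ^ 2 := by
    rw [h2, inv_im, norm_inv, inv_pow, ← Complex.normSq_eq_norm_sq]
    ring
  linear_combination h3 - h4

lemma norm_decayingRoot_le_one (hκ : κ ^ 2 < 1) (hp : 0 ≤ κ * (δ * μ)) (hz : ‖z‖ = 1) :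
    ‖decayingRoot κ μ δ z‖ ≤ 1 := by
  have h := growingRoot_im_mul κ μ δ z
  have h' := growingRoot_im_pos hκ hp hz
  by_contra! hc
  nlinarith [mul_pos h' (show 0 < ‖decayingRoot κ μ δ z‖ ^ 2 - 1 by nlinarith)]

lemma norm_decayingRoot_lt_one (hκ : κ ^ 2 < 1) (hp : 0 < κ * (δ * μ)) (hz : ‖z‖ = 1) :
    ‖decayingRoot κ μ δ z‖ < 1 := by
  refine (norm_decayingRoot_le_one hκ hp.le hz).lt_of_ne fun hc => ?_
  have h := growingRoot_im_mul κ μ δ z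
  rw [hc] at h
  linarith

/-- The Green function to the right and to the left of the origin. -/
lemma green_add_one (κ μ δ : ℝ) (z : ℂ) (k : ℤ) :
    green κ μ δ (k + 1) z =
      (if 0 ≤ k then decayingRoot κ μ δ z else growingRoot κ μ δ z) * green κ μ δ k z := by
  unfold green
  split_ifs with h
  · rw [show (k + 1).natAbs = k.natAbs + 1 by omega, pow_succ']
    ring
  · rw [show k.natAbs = (k + 1).natAbs + 1 by omega, pow_succ']
    linear_combination (-decayingRoot κ μ δ z ^ (k + 1).natAbs / (-2 * I * discRoot κ μ δ z)) *
      decayingRoot_mul_growingRoot (κ := κ) (μ := μ) (δ := δ) (z := z)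

lemma green_recurrence (hκ : κ ^ 2 < 1) (hz : ‖z‖ = 1) (k : ℤ) :
    green κ μ δ (k + 1) z + green κ μ δ (k - 1) z =
      2 * halfTrace κ μ δ z * green κ μ δ k z + if k = 0 then 1 else 0 := by
  have h1 : decayingRoot κ μ δ z + growingRoot κ μ δ z = 2 * halfTrace κ μ δ z := by
    rw [decayingRoot, growingRoot]; ring
  have h2 := decayingRoot_mul_growingRoot (κ := κ) (μ := μ) (δ := δ) (z := z)
  have e1 := green_add_one κ μ δ z k
  have e2 := green_add_one κ μ δ z (k - 1)
  rw [sub_add_cancel] at e2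
  rcases lt_trichotomy k 0 with hk | hk | hk
  · rw [if_neg (by omega)] at e1 e2
    rw [if_neg hk.ne]
    linear_combination e1 + green κ μ δ k z * h1 + decayingRoot κ μ δ z * (-e2) -
      green κ μ δ (k - 1) z * h2
  -- Both neighbours of the origin carry λ, so the defect is 2(λ - τ) g(0) with λ - τ = -i
  -- `discRoot`; the denominator of `green` normalizes it to 1.
  · subst hk
    have hw := discRoot_ne_zero (μ := μ) (δ := δ) hκ hz
    simp only [green, zero_add, zero_sub, Int.natAbs_one, Int.natAbs_neg, pow_one, Int.natAbs_zero,
      pow_zero, if_true]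
    rw [← h1, decayingRoot, growingRoot]
    field_simp
    ring
  · rw [if_pos (by omega)] at e1 e2
    rw [if_neg hk.ne']
    linear_combination e1 + green κ μ δ k z * h1 + growingRoot κ μ δ z * (-e2) -
      green κ μ δ (k - 1) z * h2

lemma conj_mul_self_of_norm (hz : ‖z‖ = 1) : conj z * z = 1 := by
  rw [mul_comm, Complex.mul_conj, Complex.normSq_eq_norm_sq, hz]; simp

/-- With S the time shift, the two symbols are twice the second column of the adjugate of S - M,
applied to `green`. The first row of the system is then a formal identity. -/
lemma symbolOne_recurrence (κ μ δ : ℝ) (z : ℂ) (k : ℤ) :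
    symbolOne κ μ δ k z =
      κ * ((conj z + I * δ * μ) * symbolOne κ μ δ (k - 1) z
        + (μ - I * δ * conj z) * symbolTwo κ μ δ (k - 1) z) := by
  simp only [symbolOne, symbolTwo, sub_add_cancel]
  ring

/-- The second row carries the source: by Cayley–Hamilton it reduces to the Green function equation.
The hypothesis `h` says that det M = 1. -/
lemma symbolTwo_recurrence (hκ : κ ^ 2 < 1) (h : κ ^ 2 * ((1 + μ ^ 2) * (1 - δ ^ 2)) = 1)
    (hz : ‖z‖ = 1) (k : ℤ) :
    symbolTwo κ μ δ k z =
      κ * ((I * δ * z - μ) * symbolOne κ μ δ (k - 1) z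
        + (z + I * δ * μ) * symbolTwo κ μ δ (k - 1) z) + 2 * if k = 0 then 1 else 0 := by
  have h' : (κ : ℂ) ^ 2 * ((1 + μ ^ 2) * (1 - δ ^ 2)) = 1 := by exact_mod_cast h
  have hg := green_recurrence (μ := μ) (δ := δ) hκ hz k
  have hc := conj_mul_self_of_norm hz
  have hr : z + conj z = 2 * z.re := by
    rw [Complex.add_conj]; push_cast; ring
  simp only [symbolOne, symbolTwo, sub_add_cancel, halfTrace] at hg ⊢
  generalize green κ μ δ (k + 1) z = a at *
  generalize green κ μ δ (k - 1) z = b at *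
  generalize green κ μ δ k z = c at *
  linear_combination 2 * hg - 2 * κ * c * hr + 2 * b * h' +
    2 * κ ^ 2 * b * (1 + I ^ 2 * δ ^ 2) * hc + 2 * κ ^ 2 * b * δ ^ 2 * (1 + μ ^ 2) * I_sq

end Pointwise

/-! ### Bounds for the symbols -/

section Bounds

variable {κ μ δ : ℝ} {z : ℂ}

/-- The bound is used with some r < 1 for summability in time at fixed δ, and with r = 1 for
estimates uniform in δ. -/
lemma norm_green_le (hκ : κ ^ 2 < 1) (hz : ‖z‖ = 1) {r : ℝ}
    (hr : ‖decayingRoot κ μ δ z‖ ≤ r) (k : ℤ) :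
    ‖green κ μ δ k z‖ ≤ r ^ k.natAbs / (2 * √(1 - κ ^ 2)) := by
  have h1 : √(1 - κ ^ 2) ≤ ‖discRoot κ μ δ z‖ :=
    Real.sqrt_le_iff.2 ⟨norm_nonneg _, one_sub_sq_le_norm_discRoot_sq hz⟩
  have h2 : 0 < √(1 - κ ^ 2) := Real.sqrt_pos.2 (sub_pos.2 hκ)
  have h3 : 0 ≤ r := (norm_nonneg _).trans hr
  rw [green, norm_div, norm_pow, norm_mul, norm_mul, norm_neg, Complex.norm_I, Complex.norm_two,
    mul_one]
  gcongr

lemma norm_symbolOne_le (hz : ‖z‖ = 1) (k : ℤ) :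
    ‖symbolOne κ μ δ k z‖ ≤ 2 * |κ| * (|μ| + |δ|) * ‖green κ μ δ k z‖ := by
  rw [symbolOne, norm_mul]
  gcongr
  rw [norm_mul, norm_mul, Complex.norm_two, Complex.norm_real, Real.norm_eq_abs]
  gcongr
  refine (norm_sub_le _ _).trans ?_
  simp [hz]

lemma norm_symbolTwo_le (hz : ‖z‖ = 1) (k : ℤ) :
    ‖symbolTwo κ μ δ k z‖ ≤ 2 * ‖green κ μ δ (k + 1) z‖ +
      2 * |κ| * (1 + |δ| * |μ|) * ‖green κ μ δ k z‖ := by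
  refine (norm_sub_le _ _).trans ?_
  rw [norm_mul, norm_mul (2 * (κ : ℂ) * _), norm_mul (2 * (κ : ℂ)), norm_mul, Complex.norm_two,
    Complex.norm_real, Real.norm_eq_abs]
  gcongr
  refine (norm_add_le _ _).trans ?_
  simp [hz]

end Bounds

/-! ### The symbols on the circle -/

/-- The dual variable `exp (2πiθ)`. -/
noncomputable def phase (θ : UnitAddCircle) : ℂ := fourier 1 θ

lemma norm_phase (θ : UnitAddCircle) : ‖phase θ‖ = 1 := by
  rw [phase, fourier_apply]; exact Circle.norm_coe _

lemma continuous_phase : Continuous phase := (fourier 1).continuous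

lemma phase_neg (θ : UnitAddCircle) : phase (-θ) = conj (phase θ) := by
  rw [phase, phase, ← fourier_neg, fourier_apply, fourier_apply, smul_neg, neg_smul]

section Circle

variable {κ μ δ : ℝ}

lemma continuous_discRoot_phase (hκ : κ ^ 2 < 1) :
    Continuous fun θ => discRoot κ μ δ (phase θ) := by
  unfold discRoot
  refine Continuous.cpow ?_ continuous_const fun θ => Or.inl (re_pos hκ (norm_phase θ))
  unfold halfTrace
  have := continuous_phase
  fun_prop

lemma continuous_decayingRoot_phase (hκ : κ ^ 2 < 1) :
    Continuous fun θ => decayingRoot κ μ δ (phase θ) := by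
  have := continuous_phase
  have := continuous_discRoot_phase (μ := μ) (δ := δ) hκ
  unfold decayingRoot halfTrace
  fun_prop

lemma continuous_green_phase (hκ : κ ^ 2 < 1) (k : ℤ) :
    Continuous fun θ => green κ μ δ k (phase θ) := by
  have h1 := continuous_discRoot_phase (μ := μ) (δ := δ) hκ
  have h2 := continuous_decayingRoot_phase (μ := μ) (δ := δ) hκ
  unfold green
  refine (h2.pow _).div (by fun_prop) fun θ => ?_
  simpa using discRoot_ne_zero hκ (norm_phase θ)

lemma continuous_symbolOne_phase (hκ : κ ^ 2 < 1) (k : ℤ) :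
    Continuous fun θ => symbolOne κ μ δ k (phase θ) := by
  have := continuous_phase
  have := continuous_green_phase (μ := μ) (δ := δ) hκ k
  unfold symbolOne
  fun_prop

lemma continuous_symbolTwo_phase (hκ : κ ^ 2 < 1) (k : ℤ) :
    Continuous fun θ => symbolTwo κ μ δ k (phase θ) := by
  have := continuous_phase
  have := continuous_green_phase (μ := μ) (δ := δ) hκ k
  have := continuous_green_phase (μ := μ) (δ := δ) hκ (k + 1)
  unfold symbolTwo
  fun_prop

lemma exists_norm_decayingRoot_le (hκ : κ ^ 2 < 1) (hp : 0 < κ * (δ * μ)) :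
    ∃ r : ℝ, 0 ≤ r ∧ r < 1 ∧ ∀ θ, ‖decayingRoot κ μ δ (phase θ)‖ ≤ r := by
  obtain ⟨θ, -, hθ⟩ := isCompact_univ.exists_isMaxOn Set.univ_nonempty
    (continuous_decayingRoot_phase (μ := μ) (δ := δ) hκ).norm.continuousOn
  exact ⟨_, norm_nonneg _, norm_decayingRoot_lt_one hκ hp (norm_phase θ),
    fun θ' => hθ (Set.mem_univ θ')⟩

lemma hasSum_norm_sq_fourierCoeff {f : UnitAddCircle → ℂ} (hf : Continuous f) :
    HasSum (fun n => ‖fourierCoeff f n‖ ^ 2) (∫ θ, ‖f θ‖ ^ 2 ∂haarAddCircle) := by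
  have h := hasSum_sq_fourierCoeff (T := 1) (ContinuousMap.toLp 2 haarAddCircle ℂ ⟨f, hf⟩)
  simp only [fourierCoeff_toLp] at h
  have e : ∫ θ, ‖f θ‖ ^ 2 ∂haarAddCircle = ∫ θ : UnitAddCircle,
      ‖ContinuousMap.toLp 2 haarAddCircle ℂ ⟨f, hf⟩ θ‖ ^ 2 ∂haarAddCircle := by
    refine integral_congr_ae ?_
    filter_upwards [ContinuousMap.coeFn_toLp (p := 2) (𝕜 := ℂ) haarAddCircle
      (⟨f, hf⟩ : C(UnitAddCircle, ℂ))] with θ hθ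
    rw [hθ]
    rfl
  rw [e]
  exact h

lemma fourierCoeff_conj_phase_mul (f : UnitAddCircle → ℂ) (n : ℤ) :
    fourierCoeff (fun θ => conj (phase θ) * f θ) n = fourierCoeff f (n + 1) := by
  unfold fourierCoeff
  congr 1 with θ
  simp only [phase, ← fourier_neg, smul_eq_mul, neg_add, fourier_add, mul_assoc]

lemma fourierCoeff_phase_mul (f : UnitAddCircle → ℂ) (n : ℤ) :
    fourierCoeff (fun θ => phase θ * f θ) n = fourierCoeff f (n - 1) := by
  unfold fourierCoeff
  congr 1 with θ
  simp only [phase, smul_eq_mul, show -(n - 1) = -n + 1 by ring, fourier_add, mul_assoc]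

lemma fourierCoeff_one (n : ℤ) :
    fourierCoeff (fun _ : UnitAddCircle => (1 : ℂ)) n = if n = 0 then 1 else 0 := by
  have h := congrFun (fourierCoeff_fourier (T := 1) 0) n
  rw [Pi.single_apply] at h
  rw [← h]
  congr 1 with θ
  simp

/-! ### Fourier coefficients of the symbols as a solution on the integer lattice. -/

/-- The first component at the lattice point `(n, k)`. -/
noncomputable def amplitudeOne (κ μ δ : ℝ) (n k : ℤ) : ℂ :=
  fourierCoeff (fun θ => symbolOne κ μ δ k (phase θ)) n

/-- The second component at the lattice point `(n, k)`. -/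
noncomputable def amplitudeTwo (κ μ δ : ℝ) (n k : ℤ) : ℂ :=
  fourierCoeff (fun θ => symbolTwo κ μ δ k (phase θ)) n

/-- The lattice equations restricted to the even sublattice, with integer coordinates. -/
structure IsIntegerSolution (κ μ δ : ℝ) (a b : ℤ → ℤ → ℂ) : Prop where
  one : ∀ n k, a n k = κ * (a (n + 1) (k - 1) - I * δ * b (n + 1) (k - 1)
    + μ * (b n (k - 1) + I * δ * a n (k - 1)))
  two : ∀ n k, b n k = κ * (b (n - 1) (k - 1) + I * δ * a (n - 1) (k - 1)
    - μ * (a n (k - 1) - I * δ * b n (k - 1)))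
    + 2 * (if n = 0 then 1 else 0) * (if k = 0 then 1 else 0)
  summable : Summable fun p : ℤ × ℤ => ‖a p.1 p.2‖ ^ 2 + ‖b p.1 p.2‖ ^ 2

lemma integrable_of_continuous {f : UnitAddCircle → ℂ} (hf : Continuous f) :
    Integrable f haarAddCircle :=
  hf.integrable_of_hasCompactSupport (HasCompactSupport.of_compactSpace f)

lemma fourierCoeff_add_of_continuous {f g : UnitAddCircle → ℂ} (hf : Continuous f)
    (hg : Continuous g) (n : ℤ) :
    fourierCoeff (fun θ => f θ + g θ) n = fourierCoeff f n + fourierCoeff g n :=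
  congrFun (fourierCoeff.add (integrable_of_continuous hf) (integrable_of_continuous hg)) n

lemma amplitudeOne_recurrence (hκ : κ ^ 2 < 1) (n k : ℤ) :
    amplitudeOne κ μ δ n k =
      κ * (amplitudeOne κ μ δ (n + 1) (k - 1) - I * δ * amplitudeTwo κ μ δ (n + 1) (k - 1)
        + μ * (amplitudeTwo κ μ δ n (k - 1) + I * δ * amplitudeOne κ μ δ n (k - 1))) := by
  have c1 := continuous_symbolOne_phase (μ := μ) (δ := δ) hκ (k - 1)
  have c2 := continuous_symbolTwo_phase (μ := μ) (δ := δ) hκ (k - 1)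
  have cp := continuous_phase
  have e : (fun θ => symbolOne κ μ δ k (phase θ)) = fun θ =>
      ((κ : ℂ) * (conj (phase θ) * symbolOne κ μ δ (k - 1) (phase θ))
      + (-(κ * I * δ) : ℂ) * (conj (phase θ) * symbolTwo κ μ δ (k - 1) (phase θ)))
      + ((κ * μ : ℂ) * symbolTwo κ μ δ (k - 1) (phase θ)
      + (κ * μ * I * δ : ℂ) * symbolOne κ μ δ (k - 1) (phase θ)) := by
    ext θ
    rw [symbolOne_recurrence]
    ring
  simp only [amplitudeOne, amplitudeTwo]
  rw [e, fourierCoeff_add_of_continuous (by fun_prop) (by fun_prop),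
    fourierCoeff_add_of_continuous (by fun_prop) (by fun_prop),
    fourierCoeff_add_of_continuous (by fun_prop) (by fun_prop)]
  simp only [fourierCoeff.const_mul, fourierCoeff_conj_phase_mul]
  ring

lemma amplitudeTwo_recurrence (hκ : κ ^ 2 < 1) (h : κ ^ 2 * ((1 + μ ^ 2) * (1 - δ ^ 2)) = 1)
    (n k : ℤ) :
    amplitudeTwo κ μ δ n k =
      κ * (amplitudeTwo κ μ δ (n - 1) (k - 1) + I * δ * amplitudeOne κ μ δ (n - 1) (k - 1)
        - μ * (amplitudeOne κ μ δ n (k - 1) - I * δ * amplitudeTwo κ μ δ n (k - 1)))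
        + 2 * (if n = 0 then 1 else 0) * (if k = 0 then 1 else 0) := by
  have c1 := continuous_symbolOne_phase (μ := μ) (δ := δ) hκ (k - 1)
  have c2 := continuous_symbolTwo_phase (μ := μ) (δ := δ) hκ (k - 1)
  have cp := continuous_phase
  have e : (fun θ => symbolTwo κ μ δ k (phase θ)) = fun θ =>
      (((κ : ℂ) * (phase θ * symbolTwo κ μ δ (k - 1) (phase θ))
      + (κ * I * δ : ℂ) * (phase θ * symbolOne κ μ δ (k - 1) (phase θ)))
      + ((-(κ * μ) : ℂ) * symbolOne κ μ δ (k - 1) (phase θ)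
      + (κ * μ * I * δ : ℂ) * symbolTwo κ μ δ (k - 1) (phase θ)))
      + (2 * (if k = 0 then 1 else 0) : ℂ) * 1 := by
    ext θ
    rw [symbolTwo_recurrence hκ h (norm_phase θ)]
    ring
  simp only [amplitudeOne, amplitudeTwo]
  rw [e, fourierCoeff_add_of_continuous (by fun_prop) (by fun_prop),
    fourierCoeff_add_of_continuous (by fun_prop) (by fun_prop),
    fourierCoeff_add_of_continuous (by fun_prop) (by fun_prop),
    fourierCoeff_add_of_continuous (by fun_prop) (by fun_prop)]
  simp only [fourierCoeff.const_mul, fourierCoeff_phase_mul, fourierCoeff_one]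
  ring

lemma summable_pow_natAbs {q : ℝ} (h0 : 0 ≤ q) (h1 : q < 1) :
    Summable fun k : ℤ => q ^ k.natAbs := by
  rw [summable_int_iff_summable_nat_and_neg]
  simpa using summable_geometric_of_lt_one h0 h1

lemma integral_norm_sq_le {f : UnitAddCircle → ℂ} (hf : Continuous f) {C : ℝ}
    (h : ∀ θ, ‖f θ‖ ^ 2 ≤ C) : ∫ θ, ‖f θ‖ ^ 2 ∂haarAddCircle ≤ C := by
  have h' := integral_mono (μ := haarAddCircle (T := 1))
    ((hf.norm.pow 2).integrable_of_hasCompactSupport (HasCompactSupport.of_compactSpace _))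
    (integrable_const C) h
  simpa using h'

/-- Parseval handles the space sum at each time; the majorant `C` handles the time sum. -/
lemma summable_norm_sq_fourierCoeff {f : ℤ → UnitAddCircle → ℂ} (hf : ∀ k, Continuous (f k))
    {C : ℤ → ℝ} (hC : Summable C) (h : ∀ k θ, ‖f k θ‖ ^ 2 ≤ C k) :
    Summable fun p : ℤ × ℤ => ‖fourierCoeff (f p.2) p.1‖ ^ 2 := by
  rw [← (Equiv.prodComm ℤ ℤ).summable_iff]
  refine (summable_prod_of_nonneg fun p => sq_nonneg _).2
    ⟨fun k => (hasSum_norm_sq_fourierCoeff (hf k)).summable, ?_⟩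
  refine hC.of_nonneg_of_le (fun k => tsum_nonneg fun n => sq_nonneg _) fun k => ?_
  exact (hasSum_norm_sq_fourierCoeff (hf k)).tsum_eq.trans_le (integral_norm_sq_le (hf k) (h k))

lemma isIntegerSolution_amplitude (hκ : κ ^ 2 < 1) (hp : 0 < κ * (δ * μ))
    (h : κ ^ 2 * ((1 + μ ^ 2) * (1 - δ ^ 2)) = 1) :
    IsIntegerSolution κ μ δ (amplitudeOne κ μ δ) (amplitudeTwo κ μ δ) := by
  refine ⟨amplitudeOne_recurrence hκ, amplitudeTwo_recurrence hκ h, ?_⟩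
  obtain ⟨r, hr0, hr1, hr⟩ := exists_norm_decayingRoot_le hκ hp
  set D := 2 * √(1 - κ ^ 2)
  have hs : Summable fun k : ℤ => (r ^ k.natAbs / D) ^ 2 := by
    have := (summable_pow_natAbs (sq_nonneg r) (by nlinarith)).div_const (D ^ 2)
    refine this.congr fun k => ?_
    rw [div_pow, ← pow_mul, ← pow_mul, mul_comm]
  have hs' : Summable fun k : ℤ => (r ^ (k + 1).natAbs / D) ^ 2 :=
    (Equiv.addRight (1 : ℤ)).summable_iff.2 hs
  have hg (k : ℤ) (θ) := norm_green_le hκ (norm_phase θ) (hr θ) k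
  refine Summable.add ?_ ?_
  · refine summable_norm_sq_fourierCoeff (f := fun k θ => symbolOne κ μ δ k (phase θ))
      (fun k => continuous_symbolOne_phase hκ k)
      (hs.mul_left ((2 * |κ| * (|μ| + |δ|)) ^ 2)) fun k θ => ?_
    rw [← mul_pow]
    gcongr
    exact (norm_symbolOne_le (norm_phase θ) k).trans (by gcongr; exact hg k θ)
  · refine summable_norm_sq_fourierCoeff (f := fun k θ => symbolTwo κ μ δ k (phase θ))
      (fun k => continuous_symbolTwo_phase hκ k)
      (((hs'.mul_left (2 ^ 2)).add (hs.mul_left ((2 * |κ| * (1 + |δ| * |μ|)) ^ 2))).mul_left 2)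
      fun k θ => ?_
    rw [← mul_pow, ← mul_pow]
    refine le_trans ?_ add_sq_le
    gcongr
    refine (norm_symbolTwo_le (norm_phase θ) k).trans ?_
    gcongr
    · exact hg (k + 1) θ
    · exact hg k θ

end Circle

/-! ### Charge conservation for the limiting amplitudes -/

section Charge

variable {κ μ : ℝ} {z : ℂ}

lemma exists_discRoot_eq_ofReal (hκ : κ ^ 2 < 1) (hz : ‖z‖ = 1) :
    ∃ x : ℝ, 0 < x ∧ discRoot κ μ 0 z = x ∧ x ^ 2 = 1 - (κ * z.re) ^ 2 := by
  have h := re_pos (μ := μ) (δ := 0) hκ hz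
  have e : (1 - halfTrace κ μ 0 z ^ 2 : ℂ) = ((1 - (κ * z.re) ^ 2 : ℝ) : ℂ) := by
    simp [halfTrace]
  rw [e, ofReal_re] at h
  refine ⟨(1 - (κ * z.re) ^ 2) ^ (2⁻¹ : ℝ), Real.rpow_pos_of_pos h _, ?_, ?_⟩
  · rw [discRoot, e, Complex.ofReal_cpow h.le]
    simp
  · rw [← Real.rpow_natCast, ← Real.rpow_mul h.le]
    norm_num

/-- The deviation of the charge density from `1` in the dual variable. -/
noncomputable def chargeDeviation (κ μ : ℝ) (z : ℂ) : ℝ := κ * z.im / (discRoot κ μ 0 z).re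

/-- At δ = 0 the root depends on z only through Re z, so the sign change comes from Im z alone. -/
lemma chargeDeviation_conj : chargeDeviation κ μ (conj z) = -chargeDeviation κ μ z := by
  simp [chargeDeviation, discRoot, halfTrace, neg_div]

/-- Let x be the real root √(1-τ²). Since |λ| = 1, |g|² = 1/(4x²). The second symbol is 2g(λ^{±1} -
κ conj z) = 2ig(κ Im z ∓ x), and x² = (κμ)² + (κ Im z)² collapses the sum of squares. -/
lemma charge_density (hκ : κ ^ 2 < 1) (h : κ ^ 2 * (1 + μ ^ 2) = 1) (hz : ‖z‖ = 1) (k : ℤ) :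
    (‖symbolOne κ μ 0 k z‖ ^ 2 + ‖symbolTwo κ μ 0 k z‖ ^ 2) / 2 =
      1 - (if 0 ≤ k then 1 else -1) * chargeDeviation κ μ z := by
  obtain ⟨x, hx0, hx, hx2⟩ := exists_discRoot_eq_ofReal (μ := μ) hκ hz
  have hre : z.re ^ 2 + z.im ^ 2 = 1 := by
    have := Complex.sq_norm z
    rw [hz, Complex.normSq_apply] at this
    linarith
  have hτ : halfTrace κ μ 0 z = ((κ * z.re : ℝ) : ℂ) := by simp [halfTrace]
  have hlam : ‖decayingRoot κ μ 0 z‖ = 1 := by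
    have : ‖decayingRoot κ μ 0 z‖ ^ 2 = 1 := by
      rw [decayingRoot, hτ, hx, Complex.sq_norm, Complex.normSq_apply]
      simp
      linarith
    exact (pow_eq_one_iff_of_nonneg (norm_nonneg _) two_ne_zero).1 this
  have hg : ‖green κ μ 0 k z‖ ^ 2 = 1 / (4 * x ^ 2) := by
    rw [green, hx, norm_div, norm_pow, hlam]
    simp [abs_of_pos hx0]
    ring
  have h1 : ‖symbolOne κ μ 0 k z‖ ^ 2 = 4 * (κ * μ) ^ 2 * ‖green κ μ 0 k z‖ ^ 2 := by
    simp only [symbolOne, ofReal_zero, mul_zero, zero_mul, sub_zero, norm_mul, mul_pow,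
      Complex.norm_two, Complex.norm_real, Real.norm_eq_abs, sq_abs]
    ring
  have h2 : ‖symbolTwo κ μ 0 k z‖ ^ 2 =
      4 * (κ * z.im - (if 0 ≤ k then 1 else -1) * x) ^ 2 * ‖green κ μ 0 k z‖ ^ 2 := by
    have e : symbolTwo κ μ 0 k z =
        2 * I * ((κ * z.im - (if 0 ≤ k then 1 else -1) * x : ℝ) : ℂ) * green κ μ 0 k z := by
      have hc : conj z = z.re - I * z.im := by
        apply Complex.ext <;> simp
      rw [symbolTwo, green_add_one, hc, decayingRoot, growingRoot, hτ, hx]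
      split_ifs <;> push_cast <;> ring
    rw [e]
    simp only [norm_mul, Complex.norm_two, Complex.norm_I, Complex.norm_real, mul_pow,
      Real.norm_eq_abs, sq_abs]
    ring
  rw [h1, h2, hg, chargeDeviation, hx, ofReal_re]
  have key : (κ * μ) ^ 2 + (κ * z.im) ^ 2 = x ^ 2 := by
    rw [hx2]; linear_combination h + κ ^ 2 * hre
  field_simp
  split_ifs <;> linear_combination key

lemma integral_chargeDeviation (κ μ : ℝ) :
    ∫ θ, chargeDeviation κ μ (phase θ) ∂haarAddCircle = 0 := by
  have h := integral_neg_eq_self (fun θ => chargeDeviation κ μ (phase θ))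
    (haarAddCircle (T := 1))
  simp only [phase_neg, chargeDeviation_conj, integral_neg] at h
  linarith

lemma continuous_chargeDeviation (hκ : κ ^ 2 < 1) :
    Continuous fun θ => chargeDeviation κ μ (phase θ) := by
  have := continuous_phase
  have hc := continuous_discRoot_phase (μ := μ) (δ := 0) hκ
  unfold chargeDeviation
  exact (by fun_prop : Continuous fun θ => κ * (phase θ).im).div (by fun_prop)
    fun θ => (discRoot_re_pos hκ (norm_phase θ)).ne'

lemma hasSum_charge (hκ : κ ^ 2 < 1) (h : κ ^ 2 * (1 + μ ^ 2) = 1) (k : ℤ) :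
    HasSum (fun n => (‖amplitudeOne κ μ 0 n k‖ ^ 2 + ‖amplitudeTwo κ μ 0 n k‖ ^ 2) / 2) 1 := by
  have c1 := continuous_symbolOne_phase (μ := μ) (δ := 0) hκ k
  have c2 := continuous_symbolTwo_phase (μ := μ) (δ := 0) hκ k
  have hs := ((hasSum_norm_sq_fourierCoeff c1).add (hasSum_norm_sq_fourierCoeff c2)).div_const 2
  have hi {f : UnitAddCircle → ℝ} (hf : Continuous f) : Integrable f haarAddCircle :=
    hf.integrable_of_hasCompactSupport (HasCompactSupport.of_compactSpace f)
  suffices e : (∫ θ, ‖symbolOne κ μ 0 k (phase θ)‖ ^ 2 ∂haarAddCircle +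
      ∫ θ, ‖symbolTwo κ μ 0 k (phase θ)‖ ^ 2 ∂haarAddCircle) / 2 = 1 by
    rwa [e] at hs
  have h1 : Continuous fun θ => ‖symbolOne κ μ 0 k (phase θ)‖ ^ 2 := c1.norm.pow 2
  have h2 : Continuous fun θ => ‖symbolTwo κ μ 0 k (phase θ)‖ ^ 2 := c2.norm.pow 2
  rw [← integral_add (hi h1) (hi h2), ← integral_div]
  simp only [charge_density hκ h (norm_phase _)]
  rw [integral_sub (integrable_const _) ((hi (continuous_chargeDeviation hκ)).const_mul _),
    integral_const_mul, integral_chargeDeviation]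
  simp

end Charge

/-! ### Uniqueness -/

section Uniqueness

lemma summable_conj_mul_shift {f : ℤ × ℤ → ℂ} (hf : Summable fun p => ‖f p‖ ^ 2) (e : ℤ × ℤ) :
    Summable fun p => (conj (f p) * f (p + e)).im := by
  have hf' : Summable fun p => ‖f (p + e)‖ ^ 2 := (Equiv.addRight e).summable_iff.2 hf
  refine Summable.of_norm_bounded (hf.add hf') fun p => ?_
  rw [Real.norm_eq_abs]
  refine (Complex.abs_im_le_norm _).trans ?_
  rw [norm_mul, RCLike.norm_conj]
  nlinarith [sq_nonneg (‖f p‖ - ‖f (p + e)‖), sq_nonneg ‖f p‖, sq_nonneg ‖f (p + e)‖]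

/-- The shift by e plus its inverse is self-adjoint: the two imaginary parts are one summable family
and minus its translate. -/
lemma hasSum_im_conj_mul_add_shift {f : ℤ × ℤ → ℂ} (hf : Summable fun p => ‖f p‖ ^ 2)
    (e : ℤ × ℤ) : HasSum (fun p => (conj (f p) * (f (p + e) + f (p - e))).im) 0 := by
  have h := (summable_conj_mul_shift hf e).hasSum
  have h' := (Equiv.subRight e).hasSum_iff.2 h
  have := h.sub h'
  rw [sub_self] at this
  refine Eq.subst (motive := fun g => HasSum g 0) (funext fun p => ?_) this
  simp only [Function.comp_apply, Equiv.subRight_apply, sub_add_cancel, mul_add, add_im, mul_im,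
    conj_re, conj_im]
  ring

/-- A square-summable solution of the lattice Klein–Gordon equation with a nonzero imaginary
part of the mass term vanishes. -/
lemma eq_zero_of_recurrence {κ η : ℝ} (hη : η ≠ 0) {f : ℤ × ℤ → ℂ}
    (hf : Summable fun p => ‖f p‖ ^ 2)
    (h : ∀ p, f (p + (0, 1)) + f (p - (0, 1)) =
      κ * (f (p + (1, 0)) + f (p - (1, 0))) + I * η * f p) (p : ℤ × ℤ) : f p = 0 := by
  -- Pairing the equation with conj f and taking imaginary parts removes every shift term, as κ is
  -- real; only η‖f‖² survives, with sum 0.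
  have h1 := hasSum_im_conj_mul_add_shift hf (0, 1)
  have h2 := (hasSum_im_conj_mul_add_shift hf (1, 0)).mul_left κ
  have h3 := h1.sub h2
  have e : (fun p => (conj (f p) * (f (p + (0, 1)) + f (p - (0, 1)))).im -
      κ * (conj (f p) * (f (p + (1, 0)) + f (p - (1, 0)))).im) = fun p => η * ‖f p‖ ^ 2 := by
    ext p
    rw [h p, Complex.sq_norm, Complex.normSq_apply]
    simp [mul_im, mul_re]
    ring
  rw [e, mul_zero, sub_zero] at h3
  have h4 := (hasSum_zero_iff_of_nonneg fun p => sq_nonneg ‖f p‖).1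
    (by simpa [hη] using h3.mul_left η⁻¹)
  simpa using congrFun h4 p

lemma summable_norm_sub_sq {ι : Type*} {f g : ι → ℂ} (hf : Summable fun i => ‖f i‖ ^ 2)
    (hg : Summable fun i => ‖g i‖ ^ 2) : Summable fun i => ‖f i - g i‖ ^ 2 := by
  refine ((hf.add hg).mul_left 2).of_nonneg_of_le (fun i => sq_nonneg _) fun i => ?_
  exact (pow_le_pow_left₀ (norm_nonneg _) (norm_sub_le _ _) 2).trans add_sq_le

variable {κ μ δ : ℝ} {a b a' b' : ℤ → ℤ → ℂ}

lemma IsIntegerSolution.summable_fst (h : IsIntegerSolution κ μ δ a b) :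
    Summable fun p : ℤ × ℤ => ‖a p.1 p.2‖ ^ 2 :=
  h.summable.of_nonneg_of_le (fun _ => sq_nonneg _) fun _ => le_add_of_nonneg_right (sq_nonneg _)

lemma IsIntegerSolution.summable_snd (h : IsIntegerSolution κ μ δ a b) :
    Summable fun p : ℤ × ℤ => ‖b p.1 p.2‖ ^ 2 :=
  h.summable.of_nonneg_of_le (fun _ => sq_nonneg _) fun _ => le_add_of_nonneg_left (sq_nonneg _)

lemma IsIntegerSolution.unique (hp : 0 < κ * (δ * μ))
    (hκ : κ ^ 2 * ((1 + μ ^ 2) * (1 - δ ^ 2)) = 1)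
    (h : IsIntegerSolution κ μ δ a b) (h' : IsIntegerSolution κ μ δ a' b') :
    a = a' ∧ b = b' := by
  have hκ' : (κ : ℂ) ^ 2 * ((1 + μ ^ 2) * (1 - δ ^ 2)) = 1 := by exact_mod_cast hκ
  set c : ℤ → ℤ → ℂ := fun n k => a n k - a' n k with hc
  set d : ℤ → ℤ → ℂ := fun n k => b n k - b' n k with hd
  have h1 (n k) : c n k = κ * (c (n + 1) (k - 1) - I * δ * d (n + 1) (k - 1)
      + μ * (d n (k - 1) + I * δ * c n (k - 1))) := by
    simp only [hc, hd]; linear_combination h.one n k - h'.one n k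
  have h2 (n k) : d n k = κ * (d (n - 1) (k - 1) + I * δ * c (n - 1) (k - 1)
      - μ * (c n (k - 1) - I * δ * d n (k - 1))) := by
    simp only [hc, hd]; linear_combination h.two n k - h'.two n k
  -- This is Im tr M. By Cayley–Hamilton each component of the difference satisfies the scalar
  -- recurrence with coefficient 2τ.
  have hη : 2 * (κ * (δ * μ)) ≠ 0 := by positivity
  have hc0 := eq_zero_of_recurrence (κ := κ) hη (f := fun p => c p.1 p.2)
    (summable_norm_sub_sq h.summable_fst h'.summable_fst) fun ⟨n, k⟩ => by
      simp only [Prod.mk_add_mk, Prod.mk_sub_mk, add_zero, sub_zero]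
      have e1 := h1 n (k + 1)
      have e2 := h1 (n - 1) k
      have e3 := h1 n k
      have e4 := h2 n k
      have e5 := h2 (n + 1) k
      simp only [add_sub_cancel_right, sub_add_cancel] at e1 e2 e3 e4 e5
      push_cast
      linear_combination e1 - κ * (e2 + I * δ * μ * e3 - μ * e4 + I * δ * e5)
        - c n (k - 1) * hκ' - κ ^ 2 * δ ^ 2 * (1 + μ ^ 2) * c n (k - 1) * I_sq
  have hd0 := eq_zero_of_recurrence (κ := κ) hη (f := fun p => d p.1 p.2)
    (summable_norm_sub_sq h.summable_snd h'.summable_snd) fun ⟨n, k⟩ => by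
      simp only [Prod.mk_add_mk, Prod.mk_sub_mk, add_zero, sub_zero]
      have e1 := h2 n (k + 1)
      have e2 := h2 (n + 1) k
      have e3 := h2 n k
      have e4 := h1 n k
      have e5 := h1 (n - 1) k
      simp only [add_sub_cancel_right, sub_add_cancel] at e1 e2 e3 e4 e5
      push_cast
      linear_combination e1 - κ * (e2 + I * δ * μ * e3 + μ * e4 - I * δ * e5)
        - d n (k - 1) * hκ' - κ ^ 2 * δ ^ 2 * (1 + μ ^ 2) * d n (k - 1) * I_sq
  exact ⟨funext₂ fun n k => sub_eq_zero.1 (hc0 (n, k)),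
    funext₂ fun n k => sub_eq_zero.1 (hd0 (n, k))⟩

end Uniqueness

/-! ### The lattice with real coordinates -/

section Lattice

/-- The product of the two normalizing factors of the lattice equations. -/
noncomputable def coupling (m ε δ : ℝ) : ℝ := 1 / √(1 + m ^ 2 * ε ^ 2) * (1 / √(1 - δ ^ 2))

/-- The integers as the lattice `εℤ`. -/
noncomputable def intEquivLattice {ε : ℝ} (hε : ε ≠ 0) : ℤ ≃ AddSubgroup.zmultiples ε :=
  Equiv.ofBijective (fun n => ⟨n • ε, AddSubgroup.zsmul_mem_zmultiples ε n⟩)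
    ⟨fun i j hij => by simpa [hε] using hij, fun ⟨x, hx⟩ => by
      obtain ⟨n, rfl⟩ := AddSubgroup.mem_zmultiples_iff.1 hx
      exact ⟨n, rfl⟩⟩

lemma coe_intEquivLattice {ε : ℝ} (hε : ε ≠ 0) (n : ℤ) :
    (intEquivLattice hε n : ℝ) = n * ε := by simp [intEquivLattice]

variable {m ε δ : ℝ} {A B : ℝ → ℝ → ℂ}

/-- One integer time step is two half-steps: an odd one followed by an even one. -/
lemma IsLatticeSolution.isIntegerSolution (hε : ε ≠ 0) (h : IsLatticeSolution m ε δ A B) :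
    IsIntegerSolution (coupling m ε δ) (m * ε) δ (fun n k => A (n * ε) (k * ε))
      (fun n k => B (n * ε) (k * ε)) := by
  have even (n : ℤ) : ∃ a : ℤ, Even a ∧ 2 * (n * ε) / ε = a :=
    ⟨2 * n, even_two_mul n, by push_cast; field_simp⟩
  have odd (n : ℤ) : ∃ a : ℤ, Odd a ∧ 2 * (n * ε + ε / 2) / ε = a :=
    ⟨2 * n + 1, odd_two_mul_add_one n, by push_cast; field_simp⟩
  refine ⟨fun n k => ?_, fun n k => ?_, ?_⟩
  · have h1 := h.even_one _ _ (even n) (even k)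
    have h2 := h.odd_one _ _ (odd n) (odd (k - 1))
    have h3 := h.odd_two _ _ (odd n) (odd (k - 1))
    have e1 : (k : ℝ) * ε - ε / 2 = ((k - 1 : ℤ) : ℝ) * ε + ε / 2 := by push_cast; ring
    have e2 : (n : ℝ) * ε + ε / 2 + ε / 2 = ((n + 1 : ℤ) : ℝ) * ε := by push_cast; ring
    rw [e2] at h2
    rw [e1, h2, h3] at h1
    simp only [add_sub_cancel_right] at h1
    rw [h1, coupling]
    push_cast
    ring
  · have h1 := h.even_two _ _ (even n) (even k)
    have h2 := h.odd_one _ _ (odd (n - 1)) (odd (k - 1))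
    have h3 := h.odd_two _ _ (odd (n - 1)) (odd (k - 1))
    have e1 : (k : ℝ) * ε - ε / 2 = ((k - 1 : ℤ) : ℝ) * ε + ε / 2 := by push_cast; ring
    have e2 : (n : ℝ) * ε - ε / 2 = ((n - 1 : ℤ) : ℝ) * ε + ε / 2 := by push_cast; ring
    have e3 : ((n - 1 : ℤ) : ℝ) * ε + ε / 2 + ε / 2 = n * ε := by push_cast; ring
    rw [e3] at h2
    rw [e1, e2, h2, h3] at h1
    simp only [add_sub_cancel_right, mul_eq_zero, hε, or_false, Int.cast_eq_zero] at h1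
    rw [h1, coupling]
    push_cast
    ring
  · have := ((intEquivLattice hε).prodCongr (intEquivLattice hε)).summable_iff.2 h.summable
    simpa [Function.comp_def, coe_intEquivLattice] using this

lemma IsIntegerSolution.exists_isLatticeSolution (hε : ε ≠ 0) {a b : ℤ → ℤ → ℂ}
    (h : IsIntegerSolution (coupling m ε δ) (m * ε) δ a b) :
    ∃ A B : ℝ → ℝ → ℂ, IsLatticeSolution m ε δ A B := by
  set s : ℂ := 1 / (√(1 - δ ^ 2) : ℂ) with hs
  -- The indices are 2x/ε and 2t/ε, of equal parity on the lattice, so testing `i` suffices. Odd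
  -- points are filled in by the odd equations; floor division sends 2n + 1 to n.
  set α : ℤ → ℤ → ℂ := fun i j => if Even i then a (i / 2) (j / 2) else
    s * (a (i / 2 + 1) (j / 2) - I * δ * b (i / 2 + 1) (j / 2)) with hα
  set β : ℤ → ℤ → ℂ := fun i j => if Even i then b (i / 2) (j / 2) else
    s * (b (i / 2) (j / 2) + I * δ * a (i / 2) (j / 2)) with hβ
  have half (n : ℤ) : (2 * n + 1) / 2 = n := by omega
  have α_even (n k : ℤ) : α (2 * n) (2 * k) = a n k := by simp [hα]
  have β_even (n k : ℤ) : β (2 * n) (2 * k) = b n k := by simp [hβ]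
  have α_odd (n k : ℤ) : α (2 * n + 1) (2 * k + 1) =
      s * (a (n + 1) k - I * δ * b (n + 1) k) := by simp [hα, half]
  have β_odd (n k : ℤ) : β (2 * n + 1) (2 * k + 1) = s * (b n k + I * δ * a n k) := by
    simp [hβ, half]
  have add (x : ℝ) : 2 * (x + ε / 2) / ε = 2 * x / ε + 1 := by field_simp
  have sub (x : ℝ) : 2 * (x - ε / 2) / ε = 2 * x / ε - 1 := by field_simp
  have radd (i : ℤ) : round ((i : ℝ) + 1) = i + 1 := by exact_mod_cast round_intCast (i + 1)
  have rsub (i : ℤ) : round ((i : ℝ) - 1) = i - 1 := by exact_mod_cast round_intCast (i - 1)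
  have zero {x : ℝ} {n : ℤ} (hx : 2 * x / ε = (2 * n : ℤ)) : x = 0 ↔ n = 0 := by
    have hx' : x = n * ε := by push_cast at hx; field_simp at hx; linarith
    simp [hx', hε]
  -- Rounding is exact at lattice points and extends the functions to all real arguments.
  refine ⟨fun x t => α (round (2 * x / ε)) (round (2 * t / ε)),
    fun x t => β (round (2 * x / ε)) (round (2 * t / ε)), ?_, ?_, ?_, ?_, ?_⟩
  · rintro x t ⟨i, hi, hx⟩ ⟨j, hj, ht⟩
    obtain ⟨n, rfl⟩ := hi.two_dvd
    obtain ⟨k, rfl⟩ := hj.two_dvd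
    simp only [add, sub, hx, ht, radd, rsub, round_intCast]
    rw [show 2 * k - 1 = 2 * (k - 1) + 1 by ring, α_even, α_odd, β_odd, h.one n k, coupling, hs]
    push_cast
    ring
  · rintro x t ⟨i, hi, hx⟩ ⟨j, hj, ht⟩
    obtain ⟨n, rfl⟩ := hi.two_dvd
    obtain ⟨k, rfl⟩ := hj.two_dvd
    simp only [zero hx, zero ht]
    simp only [sub, hx, ht, rsub, round_intCast]
    rw [show 2 * k - 1 = 2 * (k - 1) + 1 by ring, show 2 * n - 1 = 2 * (n - 1) + 1 by ring,
      β_even, α_odd, β_odd, h.two n k, coupling, hs, sub_add_cancel]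
    push_cast
    ring
  · rintro x t ⟨i, ⟨n, rfl⟩, hx⟩ ⟨j, ⟨k, rfl⟩, ht⟩
    simp only [add, sub, hx, ht, radd, rsub, round_intCast]
    rw [α_odd, add_sub_cancel_right, show 2 * n + 1 + 1 = 2 * (n + 1) by ring, α_even, β_even]
  · rintro x t ⟨i, ⟨n, rfl⟩, hx⟩ ⟨j, ⟨k, rfl⟩, ht⟩
    simp only [sub, hx, ht, rsub, round_intCast]
    rw [β_odd, add_sub_cancel_right, add_sub_cancel_right, α_even, β_even]
  · rw [← ((intEquivLattice hε).prodCongr (intEquivLattice hε)).summable_iff]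
    refine h.summable.congr fun ⟨n, k⟩ => ?_
    have r (n : ℤ) : round (2 * (n * ε) / ε) = 2 * n := by
      rw [show 2 * (n * ε) / ε = ((2 * n : ℤ) : ℝ) by push_cast; field_simp, round_intCast]
    simp only [Function.comp_apply, Equiv.prodCongr_apply, Prod.map_apply, coe_intEquivLattice, r,
      α_even, β_even]

end Lattice

/-! ### The limit -/

section Limit

variable {μ : ℝ} {z : ℂ} {l : Filter ℝ} {κ : ℝ → ℝ} {κ₀ δ₀ : ℝ}

lemma tendsto_discRoot (hκ₀ : κ₀ ^ 2 < 1) (hκ : Tendsto κ l (𝓝 κ₀)) (hl : l ≤ 𝓝 δ₀)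
    (hz : ‖z‖ = 1) :
    Tendsto (fun δ => discRoot (κ δ) μ δ z) l (𝓝 (discRoot κ₀ μ δ₀ z)) := by
  have h1 : Tendsto (fun δ => (κ δ : ℂ)) l (𝓝 κ₀) := (continuous_ofReal.tendsto _).comp hκ
  have h2 : Tendsto (fun δ : ℝ => (δ : ℂ)) l (𝓝 δ₀) := (continuous_ofReal.tendsto _).mono_left hl
  refine ((continuousAt_cpow_const (Or.inl (re_pos hκ₀ hz))).tendsto).comp ?_
  unfold halfTrace
  exact tendsto_const_nhds.sub
    ((h1.mul (tendsto_const_nhds.add ((tendsto_const_nhds.mul h2).mul tendsto_const_nhds))).pow 2)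

lemma tendsto_green (hκ₀ : κ₀ ^ 2 < 1) (hκ : Tendsto κ l (𝓝 κ₀)) (hl : l ≤ 𝓝 δ₀)
    (hz : ‖z‖ = 1) (k : ℤ) :
    Tendsto (fun δ => green (κ δ) μ δ k z) l (𝓝 (green κ₀ μ δ₀ k z)) := by
  have h1 : Tendsto (fun δ => (κ δ : ℂ)) l (𝓝 κ₀) := (continuous_ofReal.tendsto _).comp hκ
  have h2 : Tendsto (fun δ : ℝ => (δ : ℂ)) l (𝓝 δ₀) := (continuous_ofReal.tendsto _).mono_left hl
  have h3 := tendsto_discRoot (μ := μ) hκ₀ hκ hl hz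
  refine Tendsto.div (((Tendsto.sub ?_ (tendsto_const_nhds.mul h3))).pow _)
    (tendsto_const_nhds.mul h3) (by simpa using discRoot_ne_zero hκ₀ hz)
  exact h1.mul (tendsto_const_nhds.add ((tendsto_const_nhds.mul h2).mul tendsto_const_nhds))

lemma tendsto_symbolOne (hκ₀ : κ₀ ^ 2 < 1) (hκ : Tendsto κ l (𝓝 κ₀)) (hl : l ≤ 𝓝 δ₀)
    (hz : ‖z‖ = 1) (k : ℤ) :
    Tendsto (fun δ => symbolOne (κ δ) μ δ k z) l (𝓝 (symbolOne κ₀ μ δ₀ k z)) := by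
  have h1 : Tendsto (fun δ => (κ δ : ℂ)) l (𝓝 κ₀) := (continuous_ofReal.tendsto _).comp hκ
  have h2 : Tendsto (fun δ : ℝ => (δ : ℂ)) l (𝓝 δ₀) := (continuous_ofReal.tendsto _).mono_left hl
  exact ((tendsto_const_nhds.mul h1).mul (tendsto_const_nhds.sub
    ((tendsto_const_nhds.mul h2).mul tendsto_const_nhds))).mul (tendsto_green hκ₀ hκ hl hz k)

lemma tendsto_symbolTwo (hκ₀ : κ₀ ^ 2 < 1) (hκ : Tendsto κ l (𝓝 κ₀)) (hl : l ≤ 𝓝 δ₀)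
    (hz : ‖z‖ = 1) (k : ℤ) :
    Tendsto (fun δ => symbolTwo (κ δ) μ δ k z) l (𝓝 (symbolTwo κ₀ μ δ₀ k z)) := by
  have h1 : Tendsto (fun δ => (κ δ : ℂ)) l (𝓝 κ₀) := (continuous_ofReal.tendsto _).comp hκ
  have h2 : Tendsto (fun δ : ℝ => (δ : ℂ)) l (𝓝 δ₀) := (continuous_ofReal.tendsto _).mono_left hl
  exact (tendsto_const_nhds.mul (tendsto_green hκ₀ hκ hl hz (k + 1))).sub
    (((tendsto_const_nhds.mul h1).mul (tendsto_const_nhds.add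
    ((tendsto_const_nhds.mul h2).mul tendsto_const_nhds))).mul (tendsto_green hκ₀ hκ hl hz k))

lemma tendsto_fourierCoeff [l.IsCountablyGenerated] {F : ℝ → UnitAddCircle → ℂ}
    {f : UnitAddCircle → ℂ} (hF : ∀ᶠ δ in l, Continuous (F δ)) {C : ℝ}
    (hC : ∀ᶠ δ in l, ∀ θ, ‖F δ θ‖ ≤ C) (hf : ∀ θ, Tendsto (fun δ => F δ θ) l (𝓝 (f θ))) (n : ℤ) :
    Tendsto (fun δ => fourierCoeff (F δ) n) l (𝓝 (fourierCoeff f n)) := by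
  refine tendsto_integral_filter_of_dominated_convergence (fun _ => C) ?_ ?_
    (integrable_const C) (ae_of_all _ fun θ => (hf θ).const_smul _)
  · filter_upwards [hF] with δ h
    exact ((fourier (-n)).continuous.smul h).aestronglyMeasurable
  · filter_upwards [hC] with δ h
    refine ae_of_all _ fun θ => ?_
    rw [norm_smul, fourier_apply, Circle.norm_coe, one_mul]
    exact h θ

end Limit

/-! ### Identification of the propagator with the amplitudes at δ = 0. -/

section Propagator

variable {m ε δ : ℝ}

lemma coupling_pos (m ε : ℝ) (h1 : δ ^ 2 < 1) : 0 < coupling m ε δ := by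
  have : 0 < 1 - δ ^ 2 := sub_pos.2 h1
  unfold coupling
  positivity

lemma coupling_sq_mul (m ε : ℝ) (h1 : δ ^ 2 < 1) :
    coupling m ε δ ^ 2 * ((1 + (m * ε) ^ 2) * (1 - δ ^ 2)) = 1 := by
  have h2 : 0 < 1 - δ ^ 2 := sub_pos.2 h1
  have h3 : 0 < 1 + m ^ 2 * ε ^ 2 := by positivity
  rw [coupling, mul_pow, div_pow, div_pow, Real.sq_sqrt h2.le, Real.sq_sqrt h3.le]
  field_simp

lemma coupling_zero_sq_lt_one (hμ : 0 < m * ε) : coupling m ε 0 ^ 2 < 1 := by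
  have h := coupling_sq_mul (δ := 0) m ε (by norm_num)
  have := coupling_pos (δ := 0) m ε (by norm_num)
  nlinarith [mul_pos (pow_pos this 2) (pow_pos hμ 2)]

lemma tendsto_coupling (m ε : ℝ) :
    Tendsto (coupling m ε) (𝓝[>] 0) (𝓝 (coupling m ε 0)) := by
  have : ContinuousAt (coupling m ε) 0 := by
    unfold coupling
    refine continuousAt_const.mul (continuousAt_const.div (by fun_prop) (by norm_num))
  exact this.tendsto.mono_left nhdsWithin_le_nhds

/-- Existence makes the choice in `latticeSolution` a genuine solution, and uniqueness then fixes
its values on εℤ². As κ² = 1/((1+μ²)(1-δ²)), the condition `hκ` restricts δ to small values, which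
is enough for the limit. -/
lemma latticeSolution_apply (hε : ε ≠ 0) (hμ : 0 < m * ε) (hδ : 0 < δ) (h1 : δ ^ 2 < 1)
    (hκ : coupling m ε δ ^ 2 < 1) (n k : ℤ) :
    (latticeSolution m ε δ).1 (n * ε) (k * ε) = amplitudeOne (coupling m ε δ) (m * ε) δ n k ∧
    (latticeSolution m ε δ).2 (n * ε) (k * ε) = amplitudeTwo (coupling m ε δ) (m * ε) δ n k := by
  have hp : 0 < coupling m ε δ * (δ * (m * ε)) := mul_pos (coupling_pos m ε h1) (mul_pos hδ hμ)
  have hk := coupling_sq_mul m ε h1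
  have hs := isIntegerSolution_amplitude hκ hp hk
  obtain ⟨A, B, hAB⟩ := hs.exists_isLatticeSolution hε
  have h : IsLatticeSolution m ε δ (latticeSolution m ε δ).1 (latticeSolution m ε δ).2 :=
    Classical.epsilon_spec (p := fun A : (ℝ → ℝ → ℂ) × (ℝ → ℝ → ℂ) =>
      IsLatticeSolution m ε δ A.1 A.2) ⟨(A, B), hAB⟩
  obtain ⟨e1, e2⟩ := (h.isIntegerSolution hε).unique hp hk hs
  exact ⟨congrFun₂ e1 n k, congrFun₂ e2 n k⟩

/-- The gap 1 - q bounds the denominators below uniformly as δ ↘ 0, giving a constant majorant for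
dominated convergence. -/
lemma exists_eventually_bounds (hμ : 0 < m * ε) :
    ∃ q < 1, ∀ᶠ δ in 𝓝[>] (0 : ℝ), 0 < δ ∧ δ < 1 ∧ 0 < coupling m ε δ ∧
      coupling m ε δ ^ 2 < q := by
  obtain ⟨q, hq, hq1⟩ := exists_between (coupling_zero_sq_lt_one hμ)
  refine ⟨q, hq1, ?_⟩
  filter_upwards [((tendsto_coupling m ε).pow 2).eventually_lt_const hq,
    Ioo_mem_nhdsGT (zero_lt_one' ℝ)] with δ h h'
  exact ⟨h'.1, h'.2, coupling_pos m ε (by nlinarith [h'.1, h'.2]), h⟩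

lemma norm_green_le_of_sq_lt {κ μ q : ℝ} {z : ℂ} (hq : q < 1) (hκ : κ ^ 2 < q)
    (hp : 0 ≤ κ * (δ * μ)) (hz : ‖z‖ = 1) (k : ℤ) :
    ‖green κ μ δ k z‖ ≤ 1 / (2 * √(1 - q)) := by
  have h0 : 0 < 1 - q := sub_pos.2 hq
  refine (norm_green_le (hκ.trans hq) hz (norm_decayingRoot_le_one (hκ.trans hq) hp hz) k).trans ?_
  rw [one_pow]
  gcongr

lemma tendsto_amplitudeOne (hμ : 0 < m * ε) (n k : ℤ) :
    Tendsto (fun δ => amplitudeOne (coupling m ε δ) (m * ε) δ n k) (𝓝[>] 0)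
      (𝓝 (amplitudeOne (coupling m ε 0) (m * ε) 0 n k)) := by
  obtain ⟨q, hq, hev⟩ := exists_eventually_bounds hμ
  refine tendsto_fourierCoeff (C := 2 * 1 * (|m * ε| + 1) * (1 / (2 * √(1 - q)))) ?_ ?_
    (fun θ => tendsto_symbolOne (coupling_zero_sq_lt_one hμ) (tendsto_coupling m ε)
      nhdsWithin_le_nhds (norm_phase θ) k) n
  · filter_upwards [hev] with δ h
    exact continuous_symbolOne_phase (h.2.2.2.trans hq) k
  · filter_upwards [hev] with δ ⟨h0, h1, h2, h3⟩ θ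
    refine (norm_symbolOne_le (norm_phase θ) k).trans ?_
    have hk : |coupling m ε δ| ≤ 1 := (sq_le_one_iff_abs_le_one _).1 (h3.trans hq).le
    have hd : |δ| ≤ 1 := by rw [abs_of_pos h0]; exact h1.le
    gcongr
    exact norm_green_le_of_sq_lt hq h3 (by positivity) (norm_phase θ) k

lemma tendsto_amplitudeTwo (hμ : 0 < m * ε) (n k : ℤ) :
    Tendsto (fun δ => amplitudeTwo (coupling m ε δ) (m * ε) δ n k) (𝓝[>] 0)
      (𝓝 (amplitudeTwo (coupling m ε 0) (m * ε) 0 n k)) := by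
  obtain ⟨q, hq, hev⟩ := exists_eventually_bounds hμ
  refine tendsto_fourierCoeff (C := 2 * (1 / (2 * √(1 - q))) +
      2 * 1 * (1 + 1 * |m * ε|) * (1 / (2 * √(1 - q)))) ?_ ?_
    (fun θ => tendsto_symbolTwo (coupling_zero_sq_lt_one hμ) (tendsto_coupling m ε)
      nhdsWithin_le_nhds (norm_phase θ) k) n
  · filter_upwards [hev] with δ h
    exact continuous_symbolTwo_phase (h.2.2.2.trans hq) k
  · filter_upwards [hev] with δ ⟨h0, h1, h2, h3⟩ θ
    refine (norm_symbolTwo_le (norm_phase θ) k).trans ?_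
    have hk : |coupling m ε δ| ≤ 1 := (sq_le_one_iff_abs_le_one _).1 (h3.trans hq).le
    have hd : |δ| ≤ 1 := by rw [abs_of_pos h0]; exact h1.le
    have hp : 0 ≤ coupling m ε δ * (δ * (m * ε)) := by positivity
    gcongr
    · exact norm_green_le_of_sq_lt hq h3 hp (norm_phase θ) (k + 1)
    · exact norm_green_le_of_sq_lt hq h3 hp (norm_phase θ) k

lemma eventually_latticeSolution_apply (hε : ε ≠ 0) (hμ : 0 < m * ε) (n k : ℤ) :
    ∀ᶠ δ in 𝓝[>] (0 : ℝ),
      amplitudeOne (coupling m ε δ) (m * ε) δ n k = (latticeSolution m ε δ).1 (n * ε) (k * ε) ∧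
      amplitudeTwo (coupling m ε δ) (m * ε) δ n k = (latticeSolution m ε δ).2 (n * ε) (k * ε) := by
  obtain ⟨q, hq, hev⟩ := exists_eventually_bounds hμ
  filter_upwards [hev] with δ ⟨h0, h1, h2, h3⟩
  have h := latticeSolution_apply hε hμ h0 (by nlinarith) (h3.trans hq) n k
  exact ⟨h.1.symm, h.2.symm⟩

lemma propagatorOne_apply (hε : ε ≠ 0) (hμ : 0 < m * ε) (n k : ℤ) :
    propagatorOne m ε (n * ε) (k * ε) = amplitudeOne (coupling m ε 0) (m * ε) 0 n k :=
  ((tendsto_amplitudeOne hμ n k).congr'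
    ((eventually_latticeSolution_apply hε hμ n k).mono fun _ h => h.1)).limUnder_eq

lemma propagatorTwo_apply (hε : ε ≠ 0) (hμ : 0 < m * ε) (n k : ℤ) :
    propagatorTwo m ε (n * ε) (k * ε) = amplitudeTwo (coupling m ε 0) (m * ε) 0 n k :=
  ((tendsto_amplitudeTwo hμ n k).congr'
    ((eventually_latticeSolution_apply hε hμ n k).mono fun _ h => h.2)).limUnder_eq

end Propagator
end FeynmanCheckers

theorem mainTheorem11 (m ε : ℝ) (hm : 0 < m) (hε : 0 < ε)
    (t : ℝ) (ht : t ∈ AddSubgroup.zmultiples ε) :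
    HasSum (fun x : AddSubgroup.zmultiples ε =>
      (‖FeynmanCheckers.propagatorOne m ε x t‖ ^ 2
        + ‖FeynmanCheckers.propagatorTwo m ε x t‖ ^ 2) / 2) 1 := by
  obtain ⟨k, rfl⟩ := AddSubgroup.mem_zmultiples_iff.1 ht
  have hμ : 0 < m * ε := mul_pos hm hε
  rw [← (FeynmanCheckers.intEquivLattice hε.ne').hasSum_iff]
  simp only [Function.comp_def, FeynmanCheckers.coe_intEquivLattice, zsmul_eq_mul,
    FeynmanCheckers.propagatorOne_apply hε.ne' hμ, FeynmanCheckers.propagatorTwo_apply hε.ne' hμ]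
  refine FeynmanCheckers.hasSum_charge (FeynmanCheckers.coupling_zero_sq_lt_one hμ) ?_ k
  simpa using FeynmanCheckers.coupling_sq_mul (δ := 0) m ε (by norm_num)
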